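/- Let $n\ge 0$ and $w\in S_n$. Let $M_w$ be a generic $n\times 2n$ matrix whose nonzero entries in row $i$ are exactly those in columns $w(i),w(i)+1,\ldots,i+n$; generic means that these entries lie in a field extension $K/F$ and are algebraically independent over the field $F$ (for example $F=\mathbb{Q}$, $K=\mathbb{R}$). Let $P_w$ be the set of bases of the matroid of $M_w$, that is, the set of $n$-element subsets $I\subseteq\{1,\ldots,2n\}$ such that the $n\times n$ minor of $M_w$ in columns $I$ is nonzero. An anti-fixed point of $v\in S_n$ is an $i\in\{1,\ldots,n\}$ with $v(i)=n-i+1$. Put $g(v)=C_{\ell_1+1}\cdots C_{\ell_k+1}$, where $\ell_1,\ldots,\ell_k$ are the lengths of the maximal runs of consecutive anti-fixed points of $v$ and $C_j=\frac{1}{j+1}\binom{2j}{j}$ is the $j$th Catalan number (an empty product is $1$). A permutation avoids $123$ if it has no (not necessarily consecutive) increasing subsequence of length $3$. Then $$\#P_w=\sum_{\substack{v\ge w\\ v\text{ avoids }123}} g(v),$$ where $\ge$ is the strong Bruhat order on $S_n$. In particular, for $w_0=n(n-1)\cdots 1$ one has $\#P_{w_0}=C_{n+1}$. -/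

import Mathlib

/-! Permutations in `S_n` are `Equiv.Perm (Fin n)`; rows, columns, positions and values are indexed
from `0`. -/

namespace CatalanPositroid

/-- The cells `(i, j)` of an `n × 2n` matrix with `w(i) ≤ j ≤ i + n`. This inequality has the same
form whether rows, columns and values are numbered from `0` or from `1`. -/
def Support {n : ℕ} (w : Equiv.Perm (Fin n)) : Set (Fin n × Fin (2 * n)) :=
  {p | (w p.1 : ℕ) ≤ (p.2 : ℕ) ∧ (p.2 : ℕ) ≤ (p.1 : ℕ) + n}

/-- `M` is a generic matrix of the form `M_w`: its entries vanish off `Support w`, and the entries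
in `Support w` are algebraically independent over the ground field `F`. -/
structure IsGeneric (F : Type*) {K : Type*} [Field F] [Field K] [Algebra F K] {n : ℕ}
    (w : Equiv.Perm (Fin n)) (M : Matrix (Fin n) (Fin (2 * n)) K) : Prop where
  zero_off : ∀ i j, (i, j) ∉ Support w → M i j = 0
  algebraicIndependent :
    AlgebraicIndependent F (fun p : Support w => M (p : Fin n × Fin (2 * n)).1 (p : Fin n × Fin (2 * n)).2)

/-- The bases of the matroid of an `n × 2n` matrix of rank `n`: the `n`-sets `I` of columns such
that the `n × n` minor in columns `I` is nonzero. -/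
def bases {K : Type*} [Field K] {n : ℕ} (M : Matrix (Fin n) (Fin (2 * n)) K) :
    Set (Finset (Fin (2 * n))) :=
  {I | ∃ h : I.card = n, (M.submatrix id (I.orderEmbOfFin h)).det ≠ 0}

/-- One upward step of the strong Bruhat order: `v = w · (i j)` with `i < j` and `w(i) < w(j)`,
that is, multiplication by a transposition that increases the number of inversions. -/
def BruhatStep {n : ℕ} (w v : Equiv.Perm (Fin n)) : Prop :=
  ∃ i j : Fin n, i < j ∧ w i < w j ∧ v = w * Equiv.swap i j

/-- `w ≤ v` in the strong Bruhat order. -/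
def BruhatLE {n : ℕ} (w v : Equiv.Perm (Fin n)) : Prop :=
  Relation.ReflTransGen BruhatStep w v

/-- `v` has no (not necessarily consecutive) increasing subsequence of length `3`. -/
def Avoids123 {n : ℕ} (v : Equiv.Perm (Fin n)) : Prop :=
  ¬ ∃ i j k : Fin n, i < j ∧ j < k ∧ v i < v j ∧ v j < v k

/-- `i` is an anti-fixed point of `v` (with indices from `1`: `v(i) = n - i + 1`). -/
def IsAntiFixed {n : ℕ} (v : Equiv.Perm (Fin n)) (i : Fin n) : Prop :=
  v i = Fin.rev i

/-- The nonempty interval `[a, b]` consists of anti-fixed points of `v`. -/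
def IsRun {n : ℕ} (v : Equiv.Perm (Fin n)) (a b : Fin n) : Prop :=
  a ≤ b ∧ ∀ i, a ≤ i → i ≤ b → IsAntiFixed v i

/-- `[a, b]` is a maximal run of consecutive anti-fixed points of `v`. -/
def IsMaxRun {n : ℕ} (v : Equiv.Perm (Fin n)) (a b : Fin n) : Prop :=
  IsRun v a b ∧ ∀ a' b', a' ≤ a → b ≤ b' → IsRun v a' b' → a' = a ∧ b' = b

open scoped Classical in
/-- `g(v) = C_{ℓ₁+1} ⋯ C_{ℓₖ+1}`, where `ℓ₁, …, ℓₖ` are the lengths of the maximal runs of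
consecutive anti-fixed points of `v`; the run `[a, b]` has length `#[a, b]`. -/
noncomputable def g {n : ℕ} (v : Equiv.Perm (Fin n)) : ℕ :=
  ∏ r : Fin n × Fin n with IsMaxRun v r.1 r.2, catalan ((Finset.Icc r.1 r.2).card + 1)

end CatalanPositroid

/-!
A minor of a generic matrix `M_w` in the columns `I` is nonzero exactly when `I` can be matched to
the rows inside the support (`det_ne_zero_iff`). Number the columns from the middle outwards, so
that an `n`-set `I` becomes a word of `n` letters in `Bool × Bool` (`wordEquiv`): the `i`-th letter
records whether the `i`-th column to the left and the `i`-th column to the right of the middle lie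
in `I`. Let `A(y)` and `B(s)` count the columns of `I` among the first `y` to the left and the first
`s` to the right. Composing permutations with `i ↦ n + 1 - i` turns avoidance of `123` into
avoidance of `321` and anti-fixed points into fixed points; write `r_u(s, y)` for the number of
`i ≤ s` with `u(i) ≤ y`, where `u` is the composite of `w`.

A matching forces `r_u(s, y) ≤ A(y) + B(s)`, hence `r_u(s, y) ≤ min (A(y) + B(s)) s y`. The point is
that this minimum has nonnegative mixed differences, so it is itself the rank function of a
permutation (`exists_rankEq`), which must avoid `321` (`RankEq.avoids321`). Thus every `I` has an
associated `123`-avoiding `v`. A greedy matching shows that `I` is a basis for `v`, matchings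
survive steps down in Bruhat order, and comparison of rank functions is Bruhat order
(`bruhatLE_of_rk_le`); so `I` is a basis of `M_w` if and only if `w ≤ v`
(`hasMatching_iff_bruhatLE`).

It remains to count the `I` with a given `v`. The rank identity prescribes the letters at all
positions that are not fixed by `u`, and on the fixed points it says that the heights, where a
letter contributes the number of its set coordinates minus `1`, are nonnegative and vanish at the
ends of each maximal run (`InFiber.rankEq`, `RankEq.inFiber`). So a run of length `l` contributes
the number of Motzkin paths of length `l` with two kinds of level steps, which is `catalan (l + 1)`
(`numPrefix_run`, `ballot_one`, `card_inFiber`).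
-/

namespace CatalanPositroid

open Finset

variable {n : ℕ}

/-! ### Counting functions and rank functions -/

open scoped Classical in
/-- The number of indices `i < s` in `Fin n` that satisfy `P`. -/
noncomputable def cnt (P : Fin n → Prop) (s : ℕ) : ℕ :=
  #{i : Fin n | (i : ℕ) < s ∧ P i}

lemma cnt_zero (P : Fin n → Prop) : cnt P 0 = 0 := by
  simp [cnt]

open scoped Classical in
lemma cnt_succ (P : Fin n → Prop) (i : Fin n) :
    cnt P (i + 1) = cnt P i + if P i then 1 else 0 := by
  unfold cnt
  split_ifs with h
  · rw [← Finset.card_insert_of_notMem (a := i) (by simp)]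
    congr 1
    ext j
    simp only [mem_filter, mem_univ, true_and, mem_insert, Fin.ext_iff]
    constructor
    · rintro ⟨h1, h2⟩
      by_cases hj : (j : ℕ) = i
      · exact Or.inl hj
      · exact Or.inr ⟨by omega, h2⟩
    · rintro (h1 | h1)
      · exact ⟨by omega, (Fin.ext h1 : j = i) ▸ h⟩
      · exact ⟨by omega, h1.2⟩
  · refine (congrArg card (Finset.ext fun j => ?_)).trans (Nat.add_zero _).symm
    simp only [mem_filter, mem_univ, true_and]
    constructor
    · rintro ⟨h1, h2⟩
      have : (j : ℕ) ≠ i := fun e => h ((Fin.ext e : j = i) ▸ h2)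
      exact ⟨by omega, h2⟩
    · rintro ⟨h1, h2⟩
      exact ⟨by omega, h2⟩

lemma cnt_succ_of_pos {P : Fin n → Prop} {i : Fin n} (h : P i) :
    cnt P (i + 1) = cnt P i + 1 := by
  rw [cnt_succ, if_pos h]

lemma cnt_succ_of_neg {P : Fin n → Prop} {i : Fin n} (h : ¬ P i) :
    cnt P (i + 1) = cnt P i := by
  rw [cnt_succ, if_neg h, Nat.add_zero]

lemma cnt_mono (P : Fin n → Prop) {s t : ℕ} (h : s ≤ t) : cnt P s ≤ cnt P t := by
  classical
  refine card_le_card fun i hi => ?_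
  simp only [mem_filter, mem_univ, true_and] at hi ⊢
  exact ⟨by omega, hi.2⟩

lemma cnt_congr {P Q : Fin n → Prop} {s : ℕ} (h : ∀ i : Fin n, (i : ℕ) < s → (P i ↔ Q i)) :
    cnt P s = cnt Q s := by
  classical
  unfold cnt
  congr 1
  ext i
  simp only [mem_filter, mem_univ, true_and]
  exact and_congr_right fun hi => h i hi

/-- Induction up to `n` in which the step is taken at an element of `Fin n`, as in `cnt_succ`. -/
lemma cnt_induction {p : ℕ → Prop} (h0 : p 0) (hs : ∀ i : Fin n, p i → p (i + 1)) :
    ∀ s ≤ n, p s := by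
  intro s
  induction s with
  | zero => exact fun _ => h0
  | succ k ih => exact fun hk => hs ⟨k, hk⟩ (ih (by omega))

lemma cnt_add_cnt_not (P : Fin n → Prop) : ∀ s ≤ n, cnt P s + cnt (fun i => ¬ P i) s = s := by
  refine cnt_induction (by simp [cnt_zero]) fun i hi => ?_
  by_cases h : P i
  · rw [cnt_succ_of_pos h, cnt_succ_of_neg (P := fun i => ¬ P i) (not_not.2 h)]; omega
  · rw [cnt_succ_of_neg h, cnt_succ_of_pos (P := fun i => ¬ P i) h]; omega

lemma cnt_and_add_cnt_and_not (P Q : Fin n → Prop) (s : ℕ) :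
    cnt (fun i => P i ∧ Q i) s + cnt (fun i => P i ∧ ¬ Q i) s = cnt P s := by
  classical
  unfold cnt
  rw [← card_filter_add_card_filter_not (s := univ.filter fun i : Fin n => (i : ℕ) < s ∧ P i) Q]
  simp only [filter_filter, and_assoc]

/-- The number of `i < s` with `u i < y`. -/
noncomputable def rk (u : Equiv.Perm (Fin n)) (s y : ℕ) : ℕ :=
  cnt (fun i => (u i : ℕ) < y) s

lemma rk_symm (u : Equiv.Perm (Fin n)) (s y : ℕ) : rk u⁻¹ y s = rk u s y := by
  classical
  unfold rk cnt
  refine card_bij' (fun i _ => u⁻¹ i) (fun i _ => u i) ?_ ?_ ?_ ?_ <;>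
    simp +contextual

lemma rk_add_cnt (u : Equiv.Perm (Fin n)) {s : ℕ} (hs : s ≤ n) (y : ℕ) :
    rk u s y + cnt (fun i => y ≤ (u i : ℕ)) s = s := by
  simpa [rk] using cnt_add_cnt_not (fun i => (u i : ℕ) < y) s hs

lemma rk_le_left (u : Equiv.Perm (Fin n)) {s : ℕ} (hs : s ≤ n) (y : ℕ) : rk u s y ≤ s := by
  have := rk_add_cnt u hs y
  omega

lemma rk_le_right (u : Equiv.Perm (Fin n)) (s : ℕ) {y : ℕ} (hy : y ≤ n) : rk u s y ≤ y := by
  rw [← rk_symm]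
  exact rk_le_left _ hy _

lemma cnt_pos_iff {P : Fin n → Prop} {s : ℕ} : 0 < cnt P s ↔ ∃ i : Fin n, (i : ℕ) < s ∧ P i := by
  classical
  rw [cnt, card_pos]
  simp [Finset.Nonempty]

lemma rk_lt_left_iff (u : Equiv.Perm (Fin n)) {s : ℕ} (hs : s ≤ n) (y : ℕ) :
    rk u s y < s ↔ ∃ i : Fin n, (i : ℕ) < s ∧ y ≤ (u i : ℕ) := by
  rw [← cnt_pos_iff]
  have := rk_add_cnt u hs y
  omega

lemma rk_lt_right_iff (u : Equiv.Perm (Fin n)) (s : ℕ) {y : ℕ} (hy : y ≤ n) :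
    rk u s y < y ↔ ∃ i : Fin n, s ≤ (i : ℕ) ∧ (u i : ℕ) < y := by
  rw [← rk_symm, rk_lt_left_iff _ hy]
  constructor
  · rintro ⟨i, h1, h2⟩
    exact ⟨u⁻¹ i, h2, by simpa using h1⟩
  · rintro ⟨i, h1, h2⟩
    exact ⟨u i, h2, by simpa using h1⟩

lemma rk_succ_of_lt {u : Equiv.Perm (Fin n)} {i : Fin n} {y : ℕ} (h : (u i : ℕ) < y) :
    rk u (i + 1) y = rk u i y + 1 :=
  cnt_succ_of_pos (P := fun i => (u i : ℕ) < y) h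

lemma rk_succ_of_le {u : Equiv.Perm (Fin n)} {i : Fin n} {y : ℕ} (h : y ≤ (u i : ℕ)) :
    rk u (i + 1) y = rk u i y :=
  cnt_succ_of_neg (P := fun i => (u i : ℕ) < y) (not_lt.2 h)

lemma eq_of_rk_eq {u v : Equiv.Perm (Fin n)} (h : ∀ s ≤ n, ∀ y ≤ n, rk u s y = rk v s y) :
    u = v := by
  ext i
  have key : ∀ {u v : Equiv.Perm (Fin n)}, (∀ s ≤ n, ∀ y ≤ n, rk u s y = rk v s y) →
      (u i : ℕ) ≤ v i := by
    intro u v h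
    by_contra hlt
    have h1 := h i i.2.le (v i + 1) (by omega)
    have h2 := h (i + 1) (by omega) (v i + 1) (by omega)
    rw [rk_succ_of_le (by omega), rk_succ_of_lt (u := v) (by omega)] at h2
    omega
  exact le_antisymm (key h) (key fun s hs y hy => (h s hs y hy).symm)

/-- A function on the grid `[0, n]²` with the boundary values of a permutation's rank function and
nonnegative mixed differences is the rank function of a permutation. -/
lemma exists_perm_of_supermodular (ρ : ℕ → ℕ → ℕ) (h0 : ∀ s ≤ n, ρ s 0 = 0)
    (h0' : ∀ y ≤ n, ρ 0 y = 0) (hn : ∀ s ≤ n, ρ s n = s) (hn' : ∀ y ≤ n, ρ n y = y)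
    (hsup : ∀ i < n, ∀ j < n, ρ (i + 1) j + ρ i (j + 1) ≤ ρ (i + 1) (j + 1) + ρ i j) :
    ∃ u : Equiv.Perm (Fin n), ∀ s ≤ n, ∀ y ≤ n, rk u s y = ρ s y := by
  have hrow : ∀ i : Fin n, ∃ j : Fin n, ∀ y ≤ n,
      ρ (i + 1) y = ρ i y + if (j : ℕ) < y then 1 else 0 := by
    intro i
    have hex : ∃ y, y ≤ n ∧ ρ i y < ρ (i + 1) y :=
      ⟨n, le_rfl, by rw [hn _ i.2.le, hn _ i.2]; omega⟩
    classical
    obtain ⟨hy, hlt⟩ := Nat.find_spec hex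
    have hmin := fun m => Nat.find_min hex (m := m)
    set y₀ := Nat.find hex
    have hmono : ∀ a b, a ≤ b → b ≤ n → ρ (i + 1) a + ρ i b ≤ ρ (i + 1) b + ρ i a := by
      intro a b hab
      induction b, hab using Nat.le_induction with
      | base => intro _; omega
      | succ b hab ih =>
        intro hb
        have := hsup i i.2 b (by omega)
        have := ih (by omega)
        omega
    have hpos : y₀ ≠ 0 := by
      intro h
      rw [h, h0 _ i.2.le, h0 _ i.2] at hlt
      omega
    refine ⟨⟨y₀ - 1, by omega⟩, fun y hyn => ?_⟩
    have e1 := hmono y n hyn le_rfl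
    have e2 := hmono 0 y (Nat.zero_le _) hyn
    rw [hn _ i.2.le, hn _ i.2] at e1
    rw [h0 _ i.2.le, h0 _ i.2] at e2
    simp only
    split_ifs with h
    · have := hmono y₀ y (by omega) hyn
      omega
    · have := hmin y (by omega)
      push Not at this
      have := this hyn
      omega
  choose j hj using hrow
  have hcnt : ∀ y ≤ n, ∀ s ≤ n, cnt (fun i => (j i : ℕ) < y) s = ρ s y := by
    intro y hy
    refine cnt_induction (by rw [cnt_zero, h0' y hy]) fun i hi => ?_
    rw [hj i y hy, ← hi, cnt_succ]
    congr
  have hsurj : Function.Surjective j := by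
    intro y
    by_contra hno
    push Not at hno
    have h1 := hcnt y y.2.le n le_rfl
    have h2 := hcnt (y + 1) y.2 n le_rfl
    rw [hn' _ y.2.le] at h1
    rw [hn' _ y.2] at h2
    have : cnt (fun i => (j i : ℕ) < y) n = cnt (fun i => (j i : ℕ) < y + 1) n := by
      refine cnt_congr fun i _ => ?_
      have : (j i : ℕ) ≠ y := fun e => hno i (Fin.ext e)
      omega
    omega
  refine ⟨Equiv.ofBijective j (Finite.injective_iff_bijective.1
    (Finite.injective_iff_surjective.2 hsurj)), fun s hs y hy => ?_⟩
  rw [← hcnt y hy s hs]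
  rfl

/-! ### The permutation of a word -/

/-- `u` has no decreasing subsequence of length `3`. -/
def Avoids321 (u : Equiv.Perm (Fin n)) : Prop :=
  ¬ ∃ i j k : Fin n, i < j ∧ j < k ∧ u j < u i ∧ u k < u j

/-- `A(y)`: the number of letters among the first `y` whose first coordinate is set. -/
noncomputable abbrev cntFst (x : Fin n → Bool × Bool) : ℕ → ℕ := cnt fun i => (x i).1 = true

/-- `B(s)`: the number of letters among the first `s` whose second coordinate is set. -/
noncomputable abbrev cntSnd (x : Fin n → Bool × Bool) : ℕ → ℕ := cnt fun i => (x i).2 = true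

/-- The rank function of `u` is `min (A(y) + B(s)) s y`, the largest one below `A(y) + B(s)`. -/
def RankEq (u : Equiv.Perm (Fin n)) (x : Fin n → Bool × Bool) : Prop :=
  ∀ s ≤ n, ∀ y ≤ n, rk u s y = min (cntFst x y + cntSnd x s) (min s y)

lemma cnt_succ_or (P : Fin n → Prop) {i : ℕ} (hi : i < n) :
    cnt P (i + 1) = cnt P i ∨ cnt P (i + 1) = cnt P i + 1 := by
  by_cases h : P ⟨i, hi⟩
  · exact Or.inr (cnt_succ_of_pos (i := ⟨i, hi⟩) h)
  · exact Or.inl (cnt_succ_of_neg (i := ⟨i, hi⟩) h)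

lemma cnt_lipschitz (P : Fin n → Prop) {s t : ℕ} (hst : s ≤ t) (ht : t ≤ n) :
    cnt P t ≤ cnt P s + (t - s) := by
  induction t, hst using Nat.le_induction with
  | base => omega
  | succ t hst ih =>
    have := ih (by omega)
    have := cnt_succ_or P (i := t) (by omega)
    omega

lemma exists_rankEq {x : Fin n → Bool × Bool} (hx : cntFst x n + cntSnd x n = n) :
    ∃ u : Equiv.Perm (Fin n), RankEq u x := by
  have hA := fun s (hs : s ≤ n) => cnt_lipschitz (fun i => (x i).1 = true) hs le_rfl
  have hB := fun s (hs : s ≤ n) => cnt_lipschitz (fun i => (x i).2 = true) hs le_rfl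
  refine exists_perm_of_supermodular (fun s y => min (cntFst x y + cntSnd x s) (min s y))
    (by simp) (by simp) ?_ ?_ ?_
  · intro s hs
    have := hB s hs
    dsimp only [cntFst, cntSnd] at *
    omega
  · intro s hs
    have := hA s hs
    dsimp only [cntFst, cntSnd] at *
    omega
  · intro i hi j hj
    have h1 := cnt_succ_or (fun i => (x i).1 = true) hj
    have h2 := cnt_succ_or (fun i => (x i).2 = true) hi
    dsimp only [cntFst, cntSnd] at *
    rcases h1 with h1 | h1 <;> rcases h2 with h2 | h2 <;> rw [h1, h2] <;> omega

lemma RankEq.unique {u v : Equiv.Perm (Fin n)} {x : Fin n → Bool × Bool} (hu : RankEq u x)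
    (hv : RankEq v x) : u = v :=
  eq_of_rk_eq fun s hs y hy => (hu s hs y hy).trans (hv s hs y hy).symm

/-- Away from the bounds `s` and `y`, the rank function is the sum `A(y) + B(s)`, which has no mixed
differences; a middle entry of a decreasing triple would be one. -/
lemma RankEq.avoids321 {u : Equiv.Perm (Fin n)} {x : Fin n → Bool × Bool} (hu : RankEq u x) :
    Avoids321 u := by
  rintro ⟨i, j, k, hij, hjk, h1, h2⟩
  have e1 : rk u j (u j) < j := (rk_lt_left_iff u j.2.le _).2 ⟨i, hij, h1.le⟩
  have e2 : rk u j (u j) < u j := (rk_lt_right_iff u j (u j).2.le).2 ⟨k, hjk.le, h2⟩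
  have e3 : rk u j (u j + 1) = rk u j (u j) := by
    rw [← rk_symm u, ← rk_symm u]
    exact rk_succ_of_le (by simp)
  have e4 : rk u (j + 1) (u j) = rk u j (u j) := rk_succ_of_le le_rfl
  have e5 : rk u (j + 1) (u j + 1) = rk u j (u j + 1) + 1 := rk_succ_of_lt (by omega)
  rw [hu _ (by omega) _ (by omega), hu _ (by omega) _ (by omega)] at e3 e4 e5
  rw [hu _ (by omega) _ (by omega)] at e1 e2
  have h1 := cnt_succ_or (fun i => (x i).1 = true) (u j).2
  have h2 := cnt_succ_or (fun i => (x i).2 = true) j.2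
  dsimp only [cntFst, cntSnd] at *
  omega

/-! ### The words of a permutation -/

/-- The height of the word `x` after `z` letters, where only the letters at positions in `T` count:
a letter contributes `1`, `0`, `-1` according to the number of its coordinates that are set. -/
noncomputable def height (T : Fin n → Prop) (x : Fin n → Bool × Bool) (z : ℕ) : ℤ :=
  (cnt (fun i => T i ∧ (x i).1 = true) z : ℤ) - cnt (fun i => T i ∧ ¬ (x i).2 = true) z

/-- The words attached to `u`: the letter at a non-fixed position `i` records the signs of
`i - u i` and `i - u⁻¹ i`, and the letters at the fixed points form, on each maximal run of fixed
points, a path that stays nonnegative and returns to `0`. -/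
structure InFiber (u : Equiv.Perm (Fin n)) (x : Fin n → Bool × Bool) : Prop where
  snd_iff : ∀ i, u i ≠ i → ((x i).2 = true ↔ u i < i)
  fst_iff : ∀ i, u i ≠ i → ((x i).1 = true ↔ u⁻¹ i < i)
  nonneg : ∀ z ≤ n, 0 ≤ height (fun i => u i = i) x z
  eq_zero : ∀ z : Fin n, u z ≠ z → height (fun i => u i = i) x z = 0
  eq_zero_end : height (fun i => u i = i) x n = 0

/-- The number of excedances of `u` among the first `s` positions. -/
noncomputable abbrev exc (u : Equiv.Perm (Fin n)) : ℕ → ℕ := cnt fun i => i < u i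

lemma inv_ne_iff {u : Equiv.Perm (Fin n)} {i : Fin n} : u⁻¹ i ≠ i ↔ u i ≠ i := by
  rw [Ne, Equiv.Perm.inv_eq_iff_eq, eq_comm]

lemma exc_eq (u : Equiv.Perm (Fin n)) {x : Fin n → Bool × Bool}
    (h : ∀ i, u i ≠ i → ((x i).2 = true ↔ u i < i)) (s : ℕ) :
    cnt (fun i => ¬ (x i).2 = true) s =
      exc u s + cnt (fun i => u i = i ∧ ¬ (x i).2 = true) s := by
  rw [← cnt_and_add_cnt_and_not (fun i => ¬ (x i).2 = true) (fun i => u i ≠ i)]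
  congr 1
  · refine cnt_congr fun i _ => ?_
    by_cases hi : u i = i
    · simp [hi]
    · rw [h i hi, not_lt]
      exact ⟨fun h1 => lt_of_le_of_ne h1.1 (Ne.symm hi), fun h1 => ⟨h1.le, hi⟩⟩
  · exact cnt_congr fun i _ => by rw [not_not, and_comm]

lemma exc_inv_eq (u : Equiv.Perm (Fin n)) {x : Fin n → Bool × Bool}
    (h : ∀ i, u i ≠ i → ((x i).1 = true ↔ u⁻¹ i < i)) (s : ℕ) :
    cntFst x s = cnt (fun i => u⁻¹ i < i) s + cnt (fun i => u i = i ∧ (x i).1 = true) s := by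
  rw [cntFst, ← cnt_and_add_cnt_and_not (fun i => (x i).1 = true) (fun i => u i ≠ i)]
  congr 1
  · refine cnt_congr fun i _ => ?_
    by_cases hi : u i = i
    · have : u⁻¹ i = i := by rw [Equiv.Perm.inv_eq_iff_eq, hi]
      simp [hi, this]
    · rw [h i hi]
      exact ⟨fun h1 => h1.1, fun h1 => ⟨h1, hi⟩⟩
  · exact cnt_congr fun i _ => by rw [not_not, and_comm]

/-- The number of `j < y` that are values of excedances. -/
noncomputable abbrev excVal (u : Equiv.Perm (Fin n)) : ℕ → ℕ := cnt fun i => u⁻¹ i < i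

/-- In a `321`-avoiding permutation an excedance exceeds all entries to its left. -/
lemma Avoids321.lt_of_exc {u : Equiv.Perm (Fin n)} (hu : Avoids321 u) {i j : Fin n}
    (hji : j < i) (hi : i < u i) : u j < u i := by
  by_contra hlt
  have hne : u j ≠ u i := fun e => hji.ne (u.injective e)
  have h1 : rk u (i + 1) (u i) < u i := by
    rw [rk_succ_of_le le_rfl]
    exact (rk_le_left u i.2.le _).trans_lt hi
  obtain ⟨k, hk, hk'⟩ := (rk_lt_right_iff u _ (u i).2.le).1 h1
  exact hu ⟨j, i, k, hji, by omega, by omega, by omega⟩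

lemma Avoids321.rk_self_of_fixed {u : Equiv.Perm (Fin n)} (hu : Avoids321 u) {z : Fin n}
    (hz : u z = z) : rk u z z = z := by
  refine le_antisymm (rk_le_left u z.2.le _) (not_lt.1 fun hlt => ?_)
  obtain ⟨i, hi, hi'⟩ := (rk_lt_left_iff u z.2.le _).1 hlt
  obtain ⟨k, hk, hk'⟩ := (rk_lt_right_iff u _ z.2.le).1 hlt
  have h1 : u i ≠ z := fun e => by
    have := u.injective (e.trans hz.symm)
    omega
  have h2 : k ≠ z := fun e => by
    rw [e, hz] at hk'
    omega
  exact hu ⟨i, z, k, hi, by omega, by omega, by omega⟩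

lemma excVal_eq (u : Equiv.Perm (Fin n)) (y : ℕ) :
    excVal u y = cnt (fun i => i < u i ∧ (u i : ℕ) < y) n := by
  classical
  unfold excVal cnt
  refine card_bij' (fun i _ => u⁻¹ i) (fun i _ => u i) ?_ ?_ ?_ ?_ <;>
    simp +contextual

/-- To the right of the diagonal, the corank of a `321`-avoiding permutation is the truncated
difference of the numbers of excedance positions and of excedance values. -/
lemma Avoids321.rk_add_exc_sub {u : Equiv.Perm (Fin n)} (hu : Avoids321 u) {s y : ℕ} (hsy : s ≤ y)
    (hy : y ≤ n) : rk u s y + (exc u s - excVal u y) = s := by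
  classical
  have h1 := rk_add_cnt u (hsy.trans hy) y
  have h2 := cnt_and_add_cnt_and_not (fun i => i < u i) (fun i => (u i : ℕ) < y) s
  have h3 : cnt (fun i => i < u i ∧ ¬ (u i : ℕ) < y) s = cnt (fun i => y ≤ (u i : ℕ)) s :=
    cnt_congr fun i hi => ⟨fun h => not_lt.1 h.2, fun h => ⟨by omega, not_lt.2 h⟩⟩
  have h4 := cnt_mono (fun i => i < u i ∧ (u i : ℕ) < y) (hsy.trans hy)
  have h5 := excVal_eq u y
  have h6 : 0 < cnt (fun i => y ≤ (u i : ℕ)) s →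
      cnt (fun i => i < u i ∧ (u i : ℕ) < y) s = cnt (fun i => i < u i ∧ (u i : ℕ) < y) n := by
    rw [cnt_pos_iff]
    rintro ⟨i₀, hi₀, hi₀'⟩
    unfold cnt
    congr 1
    ext i
    simp only [mem_filter, mem_univ, true_and, and_congr_left_iff]
    rintro ⟨hi, hi'⟩
    refine ⟨fun _ => i.2, fun _ => ?_⟩
    by_contra hs
    have := hu.lt_of_exc (i := i) (j := i₀) (by omega) hi
    omega
  dsimp only [exc, excVal] at *
  omega

lemma excVal_le_exc (u : Equiv.Perm (Fin n)) (z : ℕ) : excVal u z ≤ exc u z := by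
  classical
  rw [excVal_eq]
  unfold exc cnt
  refine card_le_card fun i hi => ?_
  simp only [mem_filter, mem_univ, true_and] at hi ⊢
  omega

/-- The reflection of a word that corresponds to inverting the permutation. -/
def swapWord (x : Fin n → Bool × Bool) : Fin n → Bool × Bool := fun i => (x i).swap

lemma height_swapWord (T : Fin n → Prop) (x : Fin n → Bool × Bool) (z : ℕ) :
    height T (swapWord x) z = height T x z := by
  have h1 := cnt_and_add_cnt_and_not T (fun i => (x i).1 = true) z
  have h2 := cnt_and_add_cnt_and_not T (fun i => (x i).2 = true) z
  simp only [height, swapWord, Prod.fst_swap, Prod.snd_swap]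
  omega

lemma inv_eq_self_iff {u : Equiv.Perm (Fin n)} {i : Fin n} : u⁻¹ i = i ↔ u i = i := by
  rw [Equiv.Perm.inv_eq_iff_eq, eq_comm]

lemma InFiber.inv {u : Equiv.Perm (Fin n)} {x : Fin n → Bool × Bool} (h : InFiber u x) :
    InFiber u⁻¹ (swapWord x) := by
  have hT : (fun i => u⁻¹ i = i) = fun i => u i = i := funext fun i => propext inv_eq_self_iff
  constructor
  · exact fun i hi => h.fst_iff i (inv_ne_iff.1 hi)
  · exact fun i hi => by simpa [swapWord] using h.snd_iff i (inv_ne_iff.1 hi)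
  · rw [hT]
    exact fun z hz => by rw [height_swapWord]; exact h.nonneg z hz
  · rw [hT]
    exact fun z hz => by rw [height_swapWord]; exact h.eq_zero z (inv_ne_iff.1 hz)
  · rw [hT, height_swapWord]
    exact h.eq_zero_end

lemma Avoids321.inv {u : Equiv.Perm (Fin n)} (h : Avoids321 u) : Avoids321 u⁻¹ := by
  rintro ⟨i, j, k, hij, hjk, h1, h2⟩
  exact h ⟨u⁻¹ k, u⁻¹ j, u⁻¹ i, h2, h1, by simpa, by simpa⟩

lemma RankEq.inv {u : Equiv.Perm (Fin n)} {x : Fin n → Bool × Bool} (h : RankEq u x) :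
    RankEq u⁻¹ (swapWord x) := by
  intro s hs y hy
  rw [rk_symm, h y hy s hs, min_comm y s, add_comm]
  rfl

lemma InFiber.rk_eq_of_le {u : Equiv.Perm (Fin n)} {x : Fin n → Bool × Bool} (hu : Avoids321 u)
    (h : InFiber u x) {s y : ℕ} (hsy : s ≤ y) (hy : y ≤ n) :
    rk u s y = min (cntFst x y + cntSnd x s) (min s y) := by
  have h1 := hu.rk_add_exc_sub hsy hy
  have h2 := exc_eq u h.snd_iff
  have h3 := exc_inv_eq u h.fst_iff
  have h4 := cnt_add_cnt_not (fun i => (x i).2 = true) s (hsy.trans hy)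
  have h5 := h.nonneg
  unfold height at h5
  by_cases hfix : ∃ z : Fin n, s ≤ z ∧ (z : ℕ) < y ∧ u z = z
  · -- a fixed point `z` in `[s, y)` is a bottleneck: the rank is `s` and `A(y) + B(s) ≥ s`
    obtain ⟨z, hsz, hzy, hz⟩ := hfix
    have e1 := hu.rk_add_exc_sub (le_refl (z : ℕ)) z.2.le
    rw [hu.rk_self_of_fixed hz] at e1
    have e2 := cnt_mono (fun i => i < u i) hsz
    have e3 := cnt_mono (fun i => u⁻¹ i < i) hzy.le
    have e4 := cnt_mono (fun i => u i = i ∧ (x i).1 = true) hzy.le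
    have e5 := cnt_mono (fun i => u i = i ∧ ¬ (x i).2 = true) hsz
    have e6 := h5 z z.2.le
    have e7 := h2 s
    have e8 := h3 y
    dsimp only [cntFst, cntSnd, exc, excVal] at *
    omega
  · push Not at hfix
    have e4 : cnt (fun i => u i = i ∧ (x i).1 = true) y =
        cnt (fun i => u i = i ∧ (x i).1 = true) s := by
      classical
      unfold cnt
      congr 1
      ext i
      simp only [mem_filter, mem_univ, true_and, and_congr_left_iff]
      rintro ⟨hi, -⟩
      refine ⟨fun hiy => ?_, fun _ => by omega⟩
      by_contra hs
      exact hfix i (by omega) hiy hi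
    have e7 := h2 s
    have e8 := h3 y
    have e9 := h3 s
    rcases (hsy.trans hy).lt_or_eq with hs | hs
    · by_cases hz : u ⟨s, hs⟩ = ⟨s, hs⟩
      · have : s = y := by
          by_contra hne
          exact hfix ⟨s, hs⟩ le_rfl (by simp only; omega) hz
        subst this
        have e1 := hu.rk_self_of_fixed hz
        have e6 := h5 s hy
        dsimp only [cntFst, cntSnd, exc, excVal] at *
        omega
      · have e6 := h.eq_zero ⟨s, hs⟩ hz
        unfold height at e6
        dsimp only [cntFst, cntSnd, exc, excVal] at *
        omega
    · have e6 := (congrArg (height _ x) hs).trans h.eq_zero_end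
      unfold height at e6
      dsimp only [cntFst, cntSnd, exc, excVal] at *
      omega

lemma InFiber.rankEq {u : Equiv.Perm (Fin n)} {x : Fin n → Bool × Bool} (hu : Avoids321 u)
    (h : InFiber u x) : RankEq u x := by
  intro s hs y hy
  rcases le_total s y with hsy | hsy
  · exact h.rk_eq_of_le hu hsy hy
  · rw [← rk_symm, h.inv.rk_eq_of_le hu.inv hsy hs, min_comm y s, add_comm]
    rfl

lemma InFiber.cnt_add_cnt {u : Equiv.Perm (Fin n)} {x : Fin n → Bool × Bool} (hu : Avoids321 u)
    (h : InFiber u x) : cntFst x n + cntSnd x n = n := by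
  have h1 := hu.rk_add_exc_sub (le_refl n) le_rfl
  have h2 := exc_eq u h.snd_iff n
  have h3 := exc_inv_eq u h.fst_iff n
  have h4 := cnt_add_cnt_not (fun i => (x i).2 = true) n le_rfl
  have h5 := h.eq_zero_end
  have h6 := h.rankEq hu n le_rfl n le_rfl
  have h7 := excVal_le_exc u n
  have h8 : rk u n n = n := by
    have := (rk_lt_left_iff u (le_refl n) n).not.2 (by
      rintro ⟨i, -, hi⟩
      omega)
    have := rk_le_left u (le_refl n) n
    omega
  unfold height at h5
  dsimp only [cntFst, cntSnd, exc, excVal] at *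
  omega

lemma RankEq.snd_iff {u : Equiv.Perm (Fin n)} {x : Fin n → Bool × Bool} (h : RankEq u x)
    (i : Fin n) (hi : u i ≠ i) : (x i).2 = true ↔ u i < i := by
  rcases lt_or_gt_of_ne hi with hlt | hlt
  · refine iff_of_true ?_ hlt
    by_contra hx
    have e1 := rk_succ_of_lt (u := u) (i := i) (y := i) hlt
    have e2 := cnt_succ_of_neg (P := fun i => (x i).2 = true) hx
    rw [h _ (by omega) _ (by omega), h _ (by omega) _ (by omega)] at e1
    dsimp only [cntFst, cntSnd] at *
    omega
  · refine iff_of_false (fun hx => ?_) (not_lt.2 hlt.le)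
    have e1 := rk_succ_of_le (u := u) (i := i) (y := i + 1) hlt
    have e2 := cnt_succ_of_pos (P := fun i => (x i).2 = true) hx
    rw [h _ (by omega) _ (by omega), h _ (by omega) _ (by omega)] at e1
    dsimp only [cntFst, cntSnd] at *
    omega

lemma RankEq.inFiber {u : Equiv.Perm (Fin n)} {x : Fin n → Bool × Bool} (h : RankEq u x)
    (hx : cntFst x n + cntSnd x n = n) : InFiber u x := by
  have hu := h.avoids321
  have hsnd := h.snd_iff
  have hfst : ∀ i, u i ≠ i → ((x i).1 = true ↔ u⁻¹ i < i) := fun i hi =>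
    h.inv.snd_iff i (inv_ne_iff.2 hi)
  have key : ∀ z ≤ n, (rk u z z : ℤ) + height (fun i => u i = i) x z
      = cntFst x z + cntSnd x z := by
    intro z hz
    have e1 := hu.rk_add_exc_sub le_rfl hz
    have e2 := exc_eq u hsnd z
    have e3 := exc_inv_eq u hfst z
    have e4 := cnt_add_cnt_not (fun i => (x i).2 = true) z hz
    have e5 := excVal_le_exc u z
    unfold height
    dsimp only [cntFst, cntSnd, exc, excVal] at *
    omega
  have hzero : ∀ z ≤ n, rk u z z < z → height (fun i => u i = i) x z = 0 := by
    intro z hz hlt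
    have e1 := key z hz
    have e2 := h z hz z hz
    omega
  refine ⟨hsnd, hfst, fun z hz => ?_, fun z hz => ?_, ?_⟩
  · have e1 := key z hz
    have e2 := h z hz z hz
    omega
  · rcases lt_or_gt_of_ne hz with hlt | hlt
    · exact hzero z z.2.le ((rk_lt_right_iff u _ z.2.le).2 ⟨z, le_rfl, hlt⟩)
    · have e1 := hzero (z + 1) z.2
        ((rk_lt_left_iff u z.2 _).2 ⟨z, Nat.lt_succ_self _, hlt⟩)
      unfold height at e1 ⊢
      rw [cnt_succ_of_neg (by simp [hz]), cnt_succ_of_neg (by simp [hz])] at e1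
      exact e1
  · have e1 := key n le_rfl
    have e2 := h n le_rfl n le_rfl
    omega

/-! ### Counting paths -/

/-- The ballot number `C(2l+1, l+j) - C(2l+1, l+j+1)`: the number of nonnegative paths with `l`
steps from height `0` to height `j - 1`, with one kind of up-step, one kind of down-step and two
kinds of level steps. -/
def ballot (l j : ℕ) : ℤ := (2 * l + 1).choose (l + j) - (2 * l + 1).choose (l + j + 1)

lemma ballot_zero_right (l : ℕ) : ballot l 0 = 0 := by
  have : (2 * l + 1).choose (l + 1) = (2 * l + 1).choose l :=
    Nat.choose_symm_of_eq_add (by omega)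
  simp [ballot, this]

lemma ballot_zero_left (j : ℕ) : ballot 0 (j + 1) = if j = 0 then 1 else 0 := by
  rcases j with _ | j
  · simp [ballot]
  · have h1 : Nat.choose 1 (j + 1 + 1) = 0 := Nat.choose_eq_zero_of_lt (by omega)
    have h2 : Nat.choose 1 (j + 1 + 1 + 1) = 0 := Nat.choose_eq_zero_of_lt (by omega)
    simp [ballot, h1, h2]

lemma ballot_succ (l j : ℕ) :
    ballot (l + 1) (j + 1) = ballot l j + 2 * ballot l (j + 1) + ballot l (j + 2) := by
  have key : ∀ m k : ℕ, (m + 2).choose (k + 2) =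
      m.choose k + 2 * m.choose (k + 1) + m.choose (k + 2) := by
    intro m k
    rw [Nat.choose_succ_succ (m + 1) (k + 1), Nat.choose_succ_succ m k,
      Nat.choose_succ_succ m (k + 1)]
    ring
  have e1 := key (2 * l + 1) (l + j)
  have e2 := key (2 * l + 1) (l + j + 1)
  simp only [ballot]
  rw [show 2 * (l + 1) + 1 = 2 * l + 1 + 2 by ring, show l + 1 + (j + 1) = l + j + 2 by ring, e1,
    show l + j + 2 + 1 = l + j + 1 + 2 by ring, e2, show l + (j + 1) = l + j + 1 by ring,
    show l + (j + 2) = l + j + 2 by ring]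
  push_cast
  ring_nf

lemma ballot_one (l : ℕ) : ballot l 1 = catalan (l + 1) := by
  have h1 := succ_mul_catalan_eq_centralBinom (l + 1)
  have h2 : Nat.centralBinom (l + 1) = 2 * (2 * l + 1).choose (l + 1) := by
    rw [Nat.centralBinom_eq_two_mul_choose, show 2 * (l + 1) = 2 * l + 1 + 1 by ring,
      Nat.choose_succ_succ, ← Nat.choose_symm_of_eq_add (show 2 * l + 1 = (l + 1) + l by ring)]
    ring
  have h3 := Nat.choose_succ_right_eq (2 * l + 1) (l + 1)
  rw [show 2 * l + 1 - (l + 1) = l by omega] at h3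
  have h4 : ((l : ℤ) + 2) * ballot l 1 = (l + 2) * catalan (l + 1) := by
    rw [h2] at h1
    simp only [ballot]
    zify at h1 h3
    linear_combination (-1) * h1 - h3
  exact mul_left_cancel₀ (by positivity) h4

/-- The word `x` agrees with `x₀` outside the first `m` positions and outside `T`, and its
height is nonnegative up to `m`, zero at positions outside `T` before `m`, and `k` at `m`. -/
def IsPrefix (T : Fin n → Prop) (x₀ : Fin n → Bool × Bool) (m : ℕ) (k : ℤ)
    (x : Fin n → Bool × Bool) : Prop :=
  (∀ i : Fin n, m ≤ (i : ℕ) ∨ ¬ T i → x i = x₀ i) ∧ (∀ z ≤ m, 0 ≤ height T x z) ∧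
    (∀ z : Fin n, (z : ℕ) < m → ¬ T z → height T x z = 0) ∧ height T x m = k

open scoped Classical in
/-- The number of words that satisfy `IsPrefix T x₀ m k`. -/
noncomputable def numPrefix (T : Fin n → Prop) (x₀ : Fin n → Bool × Bool) (m : ℕ) (k : ℤ) : ℕ :=
  #{x | IsPrefix T x₀ m k x}

/-- The contribution of a letter to the height. -/
def letterHeight (c : Bool × Bool) : ℤ :=
  (if c.1 = true then 1 else 0) - if c.2 = true then 0 else 1

lemma height_zero (T : Fin n → Prop) (x : Fin n → Bool × Bool) : height T x 0 = 0 := by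
  simp [height, cnt_zero]

lemma height_succ_of_mem {T : Fin n → Prop} (x : Fin n → Bool × Bool) {i : Fin n} (h : T i) :
    height T x (i + 1) = height T x i + letterHeight (x i) := by
  classical
  unfold height letterHeight
  rw [cnt_succ, cnt_succ]
  cases h1 : (x i).1 <;> cases h2 : (x i).2 <;> simp [h] <;> ring

lemma height_succ_of_notMem {T : Fin n → Prop} (x : Fin n → Bool × Bool) {i : Fin n} (h : ¬ T i) :
    height T x (i + 1) = height T x i := by
  unfold height
  rw [cnt_succ_of_neg (by simp [h]), cnt_succ_of_neg (by simp [h])]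

lemma height_congr {T : Fin n → Prop} {x x' : Fin n → Bool × Bool} {z : ℕ}
    (h : ∀ i : Fin n, (i : ℕ) < z → x i = x' i) : height T x z = height T x' z := by
  unfold height
  congr 2 <;> exact cnt_congr fun i hi => by rw [h i hi]

lemma numPrefix_of_neg (T : Fin n → Prop) (x₀ : Fin n → Bool × Bool) (m : ℕ) {k : ℤ} (hk : k < 0) :
    numPrefix T x₀ m k = 0 := by
  classical
  rw [numPrefix, card_eq_zero, filter_eq_empty_iff]
  rintro x - ⟨-, h, -, h'⟩
  have := h m le_rfl
  omega

lemma numPrefix_zero (T : Fin n → Prop) (x₀ : Fin n → Bool × Bool) (k : ℤ) :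
    numPrefix T x₀ 0 k = if k = 0 then 1 else 0 := by
  classical
  unfold numPrefix
  split_ifs with hk
  · rw [card_eq_one]
    refine ⟨x₀, ?_⟩
    ext x
    simp only [mem_filter, mem_univ, true_and, mem_singleton]
    constructor
    · exact fun h => funext fun i => h.1 i (Or.inl (Nat.zero_le _))
    · rintro rfl
      refine ⟨fun _ _ => rfl, fun z hz => ?_, fun z hz => absurd hz (Nat.not_lt_zero _), ?_⟩
      · rw [Nat.le_zero.1 hz, height_zero]
      · rw [height_zero, hk]
  · rw [card_eq_zero, filter_eq_empty_iff]
    rintro x - ⟨-, -, -, h'⟩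
    rw [height_zero] at h'
    exact hk h'.symm

lemma numPrefix_succ_of_notMem {T : Fin n → Prop} (x₀ : Fin n → Bool × Bool) {m : Fin n}
    (hm : ¬ T m) (k : ℤ) :
    numPrefix T x₀ (m + 1) k = if k = 0 then numPrefix T x₀ m 0 else 0 := by
  classical
  unfold numPrefix
  split_ifs with hk
  · congr 1
    ext x
    simp only [mem_filter, mem_univ, true_and]
    constructor
    · rintro ⟨h1, h2, h3, h4⟩
      refine ⟨fun i hi => ?_, fun z hz => h2 z (by omega), fun z hz => h3 z (by omega),
        h3 m (by omega) hm⟩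
      by_cases him : i = m
      · exact h1 i (Or.inr (him ▸ hm))
      · exact h1 i (hi.imp (fun h => by have : (i : ℕ) ≠ m := fun e => him (Fin.ext e); omega) id)
    · rintro ⟨h1, h2, h3, h4⟩
      have h5 := height_succ_of_notMem x hm
      refine ⟨fun i hi => h1 i (hi.imp (fun h => by omega) id), fun z hz => ?_, fun z hz hT => ?_,
        by rw [h5, h4, hk]⟩
      · rcases Nat.lt_or_ge m z with h | h
        · rw [show z = m + 1 by omega, h5, h4]
        · exact h2 z h
      · rcases (Nat.lt_succ_iff.1 hz).lt_or_eq with h | h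
        · exact h3 z h hT
        · rw [h, h4]
  · rw [card_eq_zero, filter_eq_empty_iff]
    rintro x - ⟨-, -, h3, h4⟩
    rw [height_succ_of_notMem x hm, h3 m (by omega) hm] at h4
    exact hk h4.symm

open scoped Classical in
/-- Splitting off the last letter. -/
lemma card_prefix_letter {T : Fin n → Prop} (x₀ : Fin n → Bool × Bool) {m : Fin n}
    (hm : T m) {k : ℤ} (hk : 0 ≤ k) (c : Bool × Bool) :
    #{x | IsPrefix T x₀ (m + 1) k x ∧ x m = c} = numPrefix T x₀ m (k - letterHeight c) := by
  unfold numPrefix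
  have hup : ∀ (x : Fin n → Bool × Bool) (d : Bool × Bool), ∀ z ≤ (m : ℕ),
      height T (Function.update x m d) z = height T x z := fun x d z hz =>
    height_congr fun i hi => Function.update_of_ne (by rintro rfl; omega) _ _
  refine card_bij' (fun x _ => Function.update x m (x₀ m)) (fun x _ => Function.update x m c)
    ?_ ?_ ?_ ?_
  · simp only [mem_filter, mem_univ, true_and]
    rintro x ⟨⟨h1, h2, h3, h4⟩, rfl⟩
    refine ⟨fun i hi => ?_, fun z hz => ?_, fun z hz hT => ?_, ?_⟩
    · by_cases him : i = m
      · subst him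
        simp
      · rw [Function.update_of_ne him]
        exact h1 i (hi.imp (fun h => by have : (i : ℕ) ≠ m := fun e => him (Fin.ext e); omega) id)
    · rw [hup _ _ _ hz]
      exact h2 z (by omega)
    · rw [hup _ _ _ hz.le]
      exact h3 z (by omega) hT
    · rw [hup _ _ _ le_rfl]
      have := height_succ_of_mem x hm
      omega
  · simp only [mem_filter, mem_univ, true_and]
    rintro x ⟨h1, h2, h3, h4⟩
    have hlast : height T (Function.update x m c) (m + 1) = k := by
      rw [height_succ_of_mem _ hm, hup _ _ _ le_rfl, h4, Function.update_self]
      ring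
    refine ⟨⟨fun i hi => ?_, fun z hz => ?_, fun z hz hT => ?_, hlast⟩, Function.update_self ..⟩
    · have him : i ≠ m := by
        rintro rfl
        rcases hi with h | h
        · omega
        · exact h hm
      rw [Function.update_of_ne him]
      exact h1 i (hi.imp (fun h => by omega) id)
    · rcases Nat.lt_or_ge m z with h | h
      · rw [show z = m + 1 by omega, hlast]
        exact hk
      · rw [hup _ _ _ h]
        exact h2 z h
    · have : (z : ℕ) ≠ m := fun e => hT ((Fin.ext e : z = m) ▸ hm)
      rw [hup _ _ _ (by omega)]
      exact h3 z (by omega) hT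
  · simp only [mem_filter, mem_univ, true_and]
    rintro x ⟨-, rfl⟩
    simp
  · simp only [mem_filter, mem_univ, true_and]
    rintro x ⟨h1, -⟩
    rw [Function.update_idem, ← h1 m (Or.inl le_rfl), Function.update_eq_self]

lemma numPrefix_succ_of_mem {T : Fin n → Prop} (x₀ : Fin n → Bool × Bool) {m : Fin n}
    (hm : T m) {k : ℤ} (hk : 0 ≤ k) :
    numPrefix T x₀ (m + 1) k =
      numPrefix T x₀ m (k - 1) + 2 * numPrefix T x₀ m k + numPrefix T x₀ m (k + 1) := by
  classical
  have h1 : numPrefix T x₀ (m + 1) k =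
      ∑ c : Bool × Bool, numPrefix T x₀ m (k - letterHeight c) := by
    rw [numPrefix, card_eq_sum_card_fiberwise (f := fun x => x m) (t := univ) (by simp)]
    refine sum_congr rfl fun c _ => ?_
    rw [← card_prefix_letter x₀ hm hk c, filter_filter]
  rw [h1, Fintype.sum_prod_type]
  simp [letterHeight]
  ring

/-- Along a run contained in `T` that is entered at height `0`, the counts are ballot numbers. -/
lemma numPrefix_run {T : Fin n → Prop} (x₀ : Fin n → Bool × Bool) {p : ℕ}
    (hp : ∀ k ≠ 0, numPrefix T x₀ p k = 0) (l : ℕ)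
    (hT : ∀ i : Fin n, p ≤ (i : ℕ) → (i : ℕ) < p + l → T i) (hl : p + l ≤ n) (j : ℕ) :
    (numPrefix T x₀ (p + l) ((j : ℤ) - 1) : ℤ) = numPrefix T x₀ p 0 * ballot l j := by
  induction l generalizing j with
  | zero =>
    rcases j with _ | j
    · rw [ballot_zero_right, numPrefix_of_neg _ _ _ (by simp)]
      simp
    · rw [ballot_zero_left]
      rcases j with _ | j
      · simp
      · rw [add_zero, hp _ (by push_cast; omega)]
        simp
  | succ l ih =>
    have ih' := ih (fun i h1 h2 => hT i h1 (by omega)) (by omega)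
    rcases j with _ | j
    · rw [ballot_zero_right, numPrefix_of_neg _ _ _ (by simp)]
      simp
    · have h := numPrefix_succ_of_mem x₀ (hT ⟨p + l, by omega⟩ (by simp) (by simp))
        (k := ((j + 1 : ℕ) : ℤ) - 1) (by push_cast; omega)
      simp only at h
      rw [← add_assoc, h, ballot_succ]
      push_cast
      have e1 := ih' j
      have e2 := ih' (j + 1)
      have e3 := ih' (j + 2)
      rw [show ((j : ℤ) + 1 - 1 - 1) = j - 1 by ring, e1,
        show ((j : ℤ) + 1 - 1) = ((j + 1 : ℕ) : ℤ) - 1 by push_cast; ring, e2,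
        show ((j + 1 : ℕ) : ℤ) - 1 + 1 = ((j + 2 : ℕ) : ℤ) - 1 by push_cast; ring, e3]
      ring

/-! ### Runs of anti-fixed points -/

open scoped Classical in
/-- The part of the product `g v` over the maximal runs that end before position `m`. -/
noncomputable def gBefore (v : Equiv.Perm (Fin n)) (m : ℕ) : ℕ :=
  ∏ r : Fin n × Fin n with IsMaxRun v r.1 r.2 ∧ (r.2 : ℕ) < m,
    catalan ((Finset.Icc r.1 r.2).card + 1)

lemma gBefore_end (v : Equiv.Perm (Fin n)) : gBefore v n = g v := by
  unfold gBefore g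
  refine prod_congr (Finset.ext fun r => ?_) fun _ _ => rfl
  simp

lemma gBefore_zero (v : Equiv.Perm (Fin n)) : gBefore v 0 = 1 := by
  simp [gBefore]

lemma gBefore_succ_of_not {v : Equiv.Perm (Fin n)} {m : Fin n} (hm : ¬ IsAntiFixed v m) :
    gBefore v (m + 1) = gBefore v m := by
  classical
  unfold gBefore
  congr 1
  ext r
  simp only [mem_filter, mem_univ, true_and, and_congr_right_iff]
  intro hr
  have : (r.2 : ℕ) ≠ m := fun e => hm ((Fin.ext e : r.2 = m) ▸ hr.1.2 r.2 hr.1.1 le_rfl)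
  omega

lemma gBefore_succ_of_isMaxRun {v : Equiv.Perm (Fin n)} {p m : Fin n} (h : IsMaxRun v p m) :
    gBefore v (m + 1) = gBefore v p * catalan (((m : ℕ) + 1 - p) + 1) := by
  classical
  unfold gBefore
  have hpm : (p : ℕ) ≤ m := h.1.1
  have hins : (univ.filter fun r : Fin n × Fin n => IsMaxRun v r.1 r.2 ∧ (r.2 : ℕ) < m + 1) =
      insert (p, m) (univ.filter fun r : Fin n × Fin n => IsMaxRun v r.1 r.2 ∧ (r.2 : ℕ) < p) := by
    ext ⟨a, b⟩
    simp only [mem_filter, mem_univ, true_and, mem_insert, Prod.mk.injEq]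
    constructor
    · rintro ⟨hr, hb⟩
      by_cases hbp : (b : ℕ) < p
      · exact Or.inr ⟨hr, hbp⟩
      · -- the union of the two overlapping runs is a run, so it equals both of them
        left
        have hU : IsRun v (min a p) m := by
          refine ⟨(min_le_right _ _).trans h.1.1, fun i hi hi' => ?_⟩
          by_cases hip : p ≤ i
          · exact h.1.2 i hip hi'
          · refine hr.1.2 i ?_ (by omega)
            rcases min_le_iff.1 hi with h' | h'
            · exact h'
            · exact absurd h' hip
        have e1 := hr.2 _ _ (min_le_left _ _) (by omega) hU
        have e2 := h.2 _ _ (min_le_right _ _) le_rfl hU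
        exact ⟨e1.1.symm.trans e2.1, e1.2.symm⟩
    · rintro (⟨rfl, rfl⟩ | ⟨hr, hb⟩)
      · exact ⟨h, Nat.lt_succ_self _⟩
      · exact ⟨hr, by omega⟩
  rw [hins, prod_insert (by simp; omega), mul_comm, Fin.card_Icc]

lemma numPrefix_eq_gBefore (v : Equiv.Perm (Fin n)) (x₀ : Fin n → Bool × Bool) (m : ℕ)
    (hm : m ≤ n) (hbd : ∀ i : Fin n, IsAntiFixed v i → (i : ℕ) + 1 = m →
      ∀ j : Fin n, (j : ℕ) = m → ¬ IsAntiFixed v j) :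
    numPrefix (IsAntiFixed v) x₀ m 0 = gBefore v m := by
  classical
  induction m using Nat.strong_induction_on with
  | _ m ih =>
    rcases m with _ | m
    · rw [numPrefix_zero, gBefore_zero, if_pos rfl]
    set m' : Fin n := ⟨m, hm⟩ with hm'
    by_cases hT : IsAntiFixed v m'
    · have hex : ∃ p : ℕ, p ≤ m ∧ ∀ i : Fin n, p ≤ (i : ℕ) → (i : ℕ) ≤ m → IsAntiFixed v i :=
        ⟨m, le_rfl, fun i h1 h2 => (Fin.ext (le_antisymm h2 h1) : i = m') ▸ hT⟩
      obtain ⟨hpm, hrun⟩ := Nat.find_spec hex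
      have hmin := fun k => Nat.find_min hex (m := k)
      set p := Nat.find hex with hp
      have hstart : ∀ i : Fin n, (i : ℕ) + 1 = p → ¬ IsAntiFixed v i := by
        intro i hi hTi
        refine hmin i (by omega) ⟨by omega, fun j h1 h2 => ?_⟩
        rcases h1.lt_or_eq with h | h
        · exact hrun j (by omega) h2
        · exact (Fin.ext h : i = j) ▸ hTi
      have hmax : IsMaxRun v ⟨p, by omega⟩ m' := by
        refine ⟨⟨hpm, fun i h1 h2 => hrun i h1 h2⟩, fun a b ha hb hab => ?_⟩
        have ha' : (a : ℕ) ≤ p := ha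
        have hb' : m ≤ (b : ℕ) := hb
        constructor
        · by_contra hne
          have : (a : ℕ) ≠ p := fun e => hne (Fin.ext e)
          exact hstart ⟨p - 1, by omega⟩ (by simp only; omega)
            (hab.2 _ (Fin.le_def.2 (by simp only; omega)) (Fin.le_def.2 (by simp only; omega)))
        · by_contra hne
          have : (b : ℕ) ≠ m := fun e => hne (Fin.ext e)
          exact hbd m' hT rfl ⟨m + 1, by omega⟩ rfl
            (hab.2 _ (Fin.le_def.2 (by simp only; omega)) (Fin.le_def.2 (by simp only; omega)))
      have hp0 : ∀ k ≠ 0, numPrefix (IsAntiFixed v) x₀ p k = 0 := by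
        intro k hk
        rcases hpz : p with _ | q
        · rw [numPrefix_zero, if_neg hk]
        · rw [numPrefix_succ_of_notMem x₀ (m := ⟨q, by omega⟩) (hstart _ (by simp only; omega)),
            if_neg hk]
      have h1 := numPrefix_run x₀ hp0 (m + 1 - p) (fun i h1 h2 => hrun i h1 (by omega))
        (by omega) 1
      rw [ballot_one, ih p (by omega) (by omega) (fun i hi hip => absurd hi (hstart i hip))] at h1
      rw [gBefore_succ_of_isMaxRun hmax]
      simp only [Nat.cast_one, sub_self] at h1
      rw [show p + (m + 1 - p) = m + 1 by omega] at h1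
      exact_mod_cast h1
    · have h1 := numPrefix_succ_of_notMem x₀ hT 0
      rw [if_pos rfl] at h1
      have h2 := gBefore_succ_of_not hT
      rw [show m + 1 = (m' : ℕ) + 1 from rfl, h1, h2]
      exact ih m (Nat.lt_succ_self _) (by omega) fun i _ _ j hj => (Fin.ext hj : j = m') ▸ hT

/-- The complement of `v`: its fixed points are the anti-fixed points of `v`, and it turns
increasing subsequences into decreasing ones. -/
def compl (v : Equiv.Perm (Fin n)) : Equiv.Perm (Fin n) := v.trans Fin.revPerm

lemma compl_apply (v : Equiv.Perm (Fin n)) (i : Fin n) : compl v i = Fin.rev (v i) := rfl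

lemma compl_eq_self_iff (v : Equiv.Perm (Fin n)) (i : Fin n) : compl v i = i ↔ IsAntiFixed v i :=
  Fin.rev_eq_iff

lemma avoids321_compl_iff (v : Equiv.Perm (Fin n)) : Avoids321 (compl v) ↔ Avoids123 v := by
  simp [Avoids321, Avoids123, compl_apply]

open scoped Classical in
/-- Each maximal run of `l` anti-fixed points of `v` contributes a factor `catalan (l + 1)` to the
number of words attached to `v`. -/
lemma card_inFiber (v : Equiv.Perm (Fin n)) :
    #{x | InFiber (compl v) x} = g v := by
  rw [← gBefore_end, ← numPrefix_eq_gBefore v (fun i => (decide ((compl v)⁻¹ i < i),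
    decide (compl v i < i))) n le_rfl (by intro i _ _ j hj; omega)]
  unfold numPrefix
  congr 1
  ext x
  have hT : (fun i => compl v i = i) = IsAntiFixed v :=
    funext fun i => propext (compl_eq_self_iff v i)
  simp only [mem_filter, mem_univ, true_and]
  constructor
  · rintro ⟨h1, h2, h3, h4, h5⟩
    rw [hT] at h3 h4 h5
    refine ⟨fun i hi => ?_, h3, fun z _ hz => h4 z ((compl_eq_self_iff v z).not.2 hz), h5⟩
    have hi' := (compl_eq_self_iff v i).not.2 (hi.resolve_left (by omega))
    refine Prod.ext (Bool.eq_iff_iff.2 ?_) (Bool.eq_iff_iff.2 ?_)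
    · simpa using h2 i hi'
    · simpa using h1 i hi'
  · rintro ⟨h1, h2, h3, h4⟩
    refine ⟨fun i hi => ?_, fun i hi => ?_, ?_, fun z hz => ?_, ?_⟩
    · rw [h1 i (Or.inr ((compl_eq_self_iff v i).not.1 hi))]
      simp
    · rw [h1 i (Or.inr ((compl_eq_self_iff v i).not.1 hi))]
      simp
    · rwa [hT]
    · rw [hT]
      exact h3 z z.2 ((compl_eq_self_iff v z).not.1 hz)
    · rwa [hT]

/-! ### Bruhat order and rank functions -/

lemma rk_mul_swap (u : Equiv.Perm (Fin n)) {i j : Fin n} (hij : i < j) (hu : u j < u i) (y : ℕ) :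
    ∀ s ≤ n, rk (u * Equiv.swap i j) s y = rk u s y +
      if (i : ℕ) < s ∧ s ≤ j ∧ (u j : ℕ) < y ∧ y ≤ u i then 1 else 0 := by
  classical
  refine cnt_induction (by simp [rk, cnt_zero]) fun k hk => ?_
  have e1 := cnt_succ (fun i => (u i : ℕ) < y) k
  have e2 := cnt_succ (fun k => ((u * Equiv.swap i j) k : ℕ) < y) k
  unfold rk at hk ⊢
  rw [e1, e2, hk]
  by_cases hki : k = i
  · subst hki
    simp only [Equiv.Perm.mul_apply, Equiv.swap_apply_left]
    split_ifs <;> omega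
  · by_cases hkj : k = j
    · subst hkj
      simp only [Equiv.Perm.mul_apply, Equiv.swap_apply_right]
      split_ifs <;> omega
    · simp only [Equiv.Perm.mul_apply, Equiv.swap_apply_of_ne_of_ne hki hkj]
      split_ifs <;> omega

/-- If `u` and `t` have ordered rank functions and differ, then a transposition that removes an
inversion of `u` keeps the rank functions ordered. -/
lemma exists_swap_of_rk_le {u t : Equiv.Perm (Fin n)} (hne : u ≠ t)
    (hle : ∀ s ≤ n, ∀ y ≤ n, rk u s y ≤ rk t s y) :
    ∃ i j : Fin n, i < j ∧ u j < u i ∧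
      ∀ s ≤ n, ∀ y ≤ n, rk (u * Equiv.swap i j) s y ≤ rk t s y := by
  classical
  have hex : ∃ i : ℕ, ∃ h : i < n, u ⟨i, h⟩ ≠ t ⟨i, h⟩ := by
    by_contra h
    push Not at h
    exact hne (Equiv.ext fun i => h i i.2)
  obtain ⟨hi, hi'⟩ := Nat.find_spec hex
  have hmin := fun m => Nat.find_min hex (m := m)
  set i : Fin n := ⟨Nat.find hex, hi⟩ with hidef
  have hlow : ∀ k : Fin n, k < i → u k = t k := by
    intro k hk
    by_contra h
    exact hmin k hk ⟨k.2, h⟩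
  have hti : t i < u i := by
    refine lt_of_le_of_ne (not_lt.1 fun hlt => ?_) (Ne.symm hi')
    have e1 := hle (i + 1) i.2 (u i + 1) (u i).2
    rw [rk_succ_of_lt (by omega), rk_succ_of_le (u := t) (by omega)] at e1
    have e2 : rk u i (u i + 1) = rk t i (u i + 1) := cnt_congr fun k hk => by rw [hlow k hk]
    omega
  have hex' : ∃ j : ℕ, ∃ h : j < n, (i : ℕ) < j ∧ t i ≤ u ⟨j, h⟩ ∧ u ⟨j, h⟩ < u i := by
    refine ⟨u⁻¹ (t i), (u⁻¹ (t i)).2, ?_, by simp, by simpa using hti⟩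
    by_contra h
    rcases (not_lt.1 h).lt_or_eq with h' | h'
    · have := hlow _ h'
      rw [Equiv.Perm.coe_inv, Equiv.apply_symm_apply] at this
      have := t.injective this
      rw [← Equiv.Perm.coe_inv] at this
      omega
    · have : u⁻¹ (t i) = i := Fin.ext h'
      rw [Equiv.Perm.inv_eq_iff_eq] at this
      exact hti.ne this
  obtain ⟨hj, hij, hj1, hj2⟩ := Nat.find_spec hex'
  have hmin' := fun m => Nat.find_min hex' (m := m)
  set j : Fin n := ⟨Nat.find hex', hj⟩ with hjdef
  refine ⟨i, j, hij, hj2, fun s hs y hy => ?_⟩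
  rw [rk_mul_swap u hij hj2 y s hs]
  split_ifs with hc
  · obtain ⟨hc1, hc2, hc3, hc4⟩ := hc
    -- below height `t i` compare the ranks; between `t i` and `y` the entry `t i` is extra
    have split : ∀ r : Equiv.Perm (Fin n), rk r s y = rk r s (t i) +
        cnt (fun k => (t i : ℕ) ≤ r k ∧ (r k : ℕ) < y) s := by
      intro r
      have e := cnt_and_add_cnt_and_not (fun k => (r k : ℕ) < y) (fun k => (r k : ℕ) < t i) s
      unfold rk
      rw [← e]
      congr 1
      · exact cnt_congr fun k _ => by omega
      · exact cnt_congr fun k _ => by omega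
    have e1 := hle s hs (t i) (t i).2.le
    have e2 : cnt (fun k => (t i : ℕ) ≤ u k ∧ (u k : ℕ) < y) s + 1 ≤
        cnt (fun k => (t i : ℕ) ≤ t k ∧ (t k : ℕ) < y) s := by
      unfold cnt
      rw [← card_insert_of_notMem (a := i) (by simp; omega)]
      refine card_le_card fun k hk => ?_
      simp only [mem_insert, mem_filter, mem_univ, true_and] at hk ⊢
      rcases hk with rfl | ⟨h1, h2, h3⟩
      · omega
      · have hki : k < i := by
          by_contra hki
          have hne : k ≠ i := by
            rintro rfl
            omega
          have hik : i < k := lt_of_le_of_ne (not_lt.1 hki) (Ne.symm hne)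
          refine hmin' k (lt_of_lt_of_le h1 hc2) ⟨k.2, hik, h2, ?_⟩
          exact Fin.lt_def.2 (by simp only [Fin.eta]; omega)
        rw [← hlow k hki]
        exact ⟨h1, h2, h3⟩
    rw [split u, split t]
    omega
  · exact hle s hs y hy

lemma sum_mul_swap_lt (w : Equiv.Perm (Fin n)) {i j : Fin n} (hij : i < j) (hw : w i < w j) :
    ∑ k : Fin n, (k : ℕ) * ((w * Equiv.swap i j) k : ℕ) < ∑ k : Fin n, (k : ℕ) * (w k : ℕ) := by
  classical
  have hsplit : ∀ f : Fin n → ℕ, ∑ k, f k = f i + (f j + ∑ k ∈ (univ.erase i).erase j, f k) := by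
    intro f
    rw [add_sum_erase _ _ (by simp [hij.ne']), add_sum_erase _ _ (mem_univ i)]
  rw [hsplit, hsplit fun k => (k : ℕ) * (w k : ℕ)]
  have hrest : ∑ k ∈ (univ.erase i).erase j, (k : ℕ) * ((w * Equiv.swap i j) k : ℕ) =
      ∑ k ∈ (univ.erase i).erase j, (k : ℕ) * (w k : ℕ) := by
    refine sum_congr rfl fun k hk => ?_
    simp only [mem_erase, mem_univ, and_true] at hk
    rw [Equiv.Perm.mul_apply, Equiv.swap_apply_of_ne_of_ne hk.2 hk.1]
  rw [hrest]
  simp only [Equiv.Perm.mul_apply, Equiv.swap_apply_left, Equiv.swap_apply_right]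
  obtain ⟨a, ha⟩ := Nat.exists_eq_add_of_lt (Fin.lt_def.1 hij)
  obtain ⟨b, hb⟩ := Nat.exists_eq_add_of_lt (Fin.lt_def.1 hw)
  rw [ha, hb]
  nlinarith

lemma compl_injective : Function.Injective (compl (n := n)) := by
  intro v w h
  ext i
  have := congrArg (fun u => Fin.rev (u i)) h
  simpa [compl_apply, Fin.ext_iff] using this

/-- The rank criterion for the strong Bruhat order. The induction is on `∑ k, k * w k`, which each
upward step decreases. -/
lemma bruhatLE_of_rk_le (w v : Equiv.Perm (Fin n))
    (hle : ∀ s ≤ n, ∀ y ≤ n, rk (compl w) s y ≤ rk (compl v) s y) : BruhatLE w v := by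
  induction hN : ∑ k : Fin n, (k : ℕ) * (w k : ℕ) using Nat.strong_induction_on generalizing w with
  | _ N ih =>
    by_cases hwv : w = v
    · rw [hwv]
      exact Relation.ReflTransGen.refl
    · obtain ⟨i, j, hij, hu, hle'⟩ := exists_swap_of_rk_le (compl_injective.ne hwv) hle
      have hw : w i < w j := by simpa [compl_apply] using hu
      have hN' := sum_mul_swap_lt w hij hw
      rw [hN] at hN'
      exact Relation.ReflTransGen.head ⟨i, j, hij, hw, rfl⟩ (ih _ hN' _ hle' rfl)

/-! ### Matchings -/

/-- The columns `I` can be matched to the rows inside the support of `M_w`. -/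
def HasMatching (w : Equiv.Perm (Fin n)) (I : Finset (Fin (2 * n))) : Prop :=
  ∃ f : Fin n → Fin (2 * n), Function.Injective f ∧ ∀ i, f i ∈ I ∧ (i, f i) ∈ Support w

lemma HasMatching.of_bruhatStep {w v : Equiv.Perm (Fin n)} {I : Finset (Fin (2 * n))}
    (h : BruhatStep w v) (hv : HasMatching v I) : HasMatching w I := by
  obtain ⟨i, j, hij, hw, rfl⟩ := h
  obtain ⟨f, hf, hS⟩ := hv
  have hi := (hS i).2
  have hj := (hS j).2
  simp only [Support, Set.mem_ofPred_eq, Equiv.Perm.mul_apply, Equiv.swap_apply_left,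
    Equiv.swap_apply_right] at hi hj
  have hk : ∀ k, k ≠ i → k ≠ j → (k, f k) ∈ Support w := by
    intro k h1 h2
    have := (hS k).2
    simpa only [Support, Set.mem_ofPred_eq, Equiv.Perm.mul_apply,
      Equiv.swap_apply_of_ne_of_ne h1 h2] using this
  by_cases hc : (w j : ℕ) ≤ f j
  · refine ⟨f, hf, fun k => ⟨(hS k).1, ?_⟩⟩
    by_cases h1 : k = i
    · subst h1
      simp only [Support, Set.mem_ofPred_eq]
      omega
    · by_cases h2 : k = j
      · subst h2
        simp only [Support, Set.mem_ofPred_eq]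
        omega
      · exact hk k h1 h2
  · -- the column of row `j` lies to the left of `w j`, so the two rows exchange their columns
    refine ⟨f ∘ Equiv.swap i j, hf.comp (Equiv.swap i j).injective, fun k => ⟨(hS _).1, ?_⟩⟩
    by_cases h1 : k = i
    · subst h1
      simp only [Support, Set.mem_ofPred_eq, Function.comp, Equiv.swap_apply_left]
      omega
    · by_cases h2 : k = j
      · subst h2
        simp only [Support, Set.mem_ofPred_eq, Function.comp, Equiv.swap_apply_right]
        omega
      · simpa only [Function.comp, Equiv.swap_apply_of_ne_of_ne h1 h2] using hk k h1 h2

lemma HasMatching.of_bruhatLE {w v : Equiv.Perm (Fin n)} {I : Finset (Fin (2 * n))}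
    (h : BruhatLE w v) (hv : HasMatching v I) : HasMatching w I := by
  induction h with
  | refl => exact hv
  | tail _ hstep ih => exact ih (hv.of_bruhatStep hstep)

/-- The columns of the left half, numbered from the middle to the left. -/
def lowCol (i : Fin n) : Fin (2 * n) := ⟨n - 1 - i, by omega⟩

/-- The columns of the right half, numbered from the middle to the right. -/
def highCol (i : Fin n) : Fin (2 * n) := ⟨n + i, by omega⟩

/-- The columns, read from the middle outwards in both directions. -/
noncomputable def colEquiv (n : ℕ) : Fin n ⊕ Fin n ≃ Fin (2 * n) :=
  Equiv.ofBijective (Sum.elim lowCol highCol) <| by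
    rw [Fintype.bijective_iff_injective_and_card]
    constructor
    · rintro (i | i) (j | j) h <;>
        simp only [Sum.elim_inl, Sum.elim_inr, lowCol, highCol, Fin.mk.injEq] at h
      · rw [show i = j from Fin.ext (by omega)]
      · omega
      · omega
      · rw [show i = j from Fin.ext (by omega)]
    · simp [two_mul]

lemma colEquiv_inl (i : Fin n) : colEquiv n (Sum.inl i) = lowCol i := rfl

lemma colEquiv_inr (i : Fin n) : colEquiv n (Sum.inr i) = highCol i := rfl

open scoped Classical in
/-- A set of columns as a word: the letter at `i` tells which of the columns `lowCol i` and
`highCol i` belong to the set. -/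
noncomputable def wordEquiv (n : ℕ) : Finset (Fin (2 * n)) ≃ (Fin n → Bool × Bool) where
  toFun I i := (decide (lowCol i ∈ I), decide (highCol i ∈ I))
  invFun x := {c | Sum.elim (fun i => (x i).1) (fun i => (x i).2) ((colEquiv n).symm c) = true}
  left_inv I := by
    ext c
    obtain ⟨c, rfl⟩ := (colEquiv n).surjective c
    rcases c with i | i
    · simp only [mem_filter, mem_univ, true_and, Equiv.symm_apply_apply, Sum.elim_inl,
        decide_eq_true_eq]
      rw [colEquiv_inl]
    · simp only [mem_filter, mem_univ, true_and, Equiv.symm_apply_apply, Sum.elim_inr,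
        decide_eq_true_eq]
      rw [colEquiv_inr]
  right_inv x := by
    funext i
    simp [← colEquiv_inl, ← colEquiv_inr]

lemma wordEquiv_fst (I : Finset (Fin (2 * n))) (i : Fin n) :
    (wordEquiv n I i).1 = true ↔ lowCol i ∈ I := by
  simp [wordEquiv]

lemma wordEquiv_snd (I : Finset (Fin (2 * n))) (i : Fin n) :
    (wordEquiv n I i).2 = true ↔ highCol i ∈ I := by
  simp [wordEquiv]

lemma card_eq_cnt (I : Finset (Fin (2 * n))) :
    #I = cntFst (wordEquiv n I) n + cntSnd (wordEquiv n I) n := by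
  classical
  have h : #I = ∑ c : Fin (2 * n), if c ∈ I then 1 else 0 := by simp
  rw [h, ← (colEquiv n).sum_comp, Fintype.sum_sum_type]
  simp only [cntFst, cntSnd, cnt, wordEquiv_fst, wordEquiv_snd, Fin.is_lt, true_and, card_filter,
    colEquiv_inl, colEquiv_inr]
  congr

/-- The rows among the first `s` whose intervals start in the last `y` columns of the left half are
matched into the window of columns that the bound counts. -/
lemma HasMatching.rk_le {w : Equiv.Perm (Fin n)} {I : Finset (Fin (2 * n))} (h : HasMatching w I)
    (s y : ℕ) :
    rk (compl w) s y ≤ cntFst (wordEquiv n I) y + cntSnd (wordEquiv n I) s := by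
  classical
  obtain ⟨f, hf, hS⟩ := h
  rw [rk, ← cnt_and_add_cnt_and_not _ (fun i => (f i : ℕ) < n)]
  have hS' := fun i => (hS i).2
  simp only [Support, Set.mem_ofPred_eq] at hS'
  have hI := fun i => (hS i).1
  refine add_le_add ?_ ?_
  · refine card_le_card_of_injOn
      (fun i => if h : (f i : ℕ) < n then ⟨n - 1 - f i, by omega⟩ else i) ?_ ?_
    · intro i hi
      simp only [coe_filter, mem_univ, true_and, Set.mem_ofPred_eq, wordEquiv_fst] at hi ⊢
      obtain ⟨h1, h2, h3⟩ := hi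
      rw [compl_apply, Fin.val_rev] at h2
      have := hS' i
      rw [dif_pos h3]
      refine ⟨by simp only; omega, ?_⟩
      have e : lowCol (⟨n - 1 - f i, by omega⟩ : Fin n) = f i :=
        Fin.ext (by simp only [lowCol]; omega)
      rw [e]
      exact hI i
    · intro i hi j hj hij
      simp only [coe_filter, mem_univ, true_and, Set.mem_ofPred_eq] at hi hj
      simp only [dif_pos hi.2.2, dif_pos hj.2.2, Fin.mk.injEq] at hij
      have := hi.2.2
      have := hj.2.2
      exact hf (Fin.ext (by omega))
  · refine card_le_card_of_injOn
      (fun i => if h : n ≤ (f i : ℕ) then ⟨f i - n, by omega⟩ else i) ?_ ?_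
    · intro i hi
      simp only [coe_filter, mem_univ, true_and, Set.mem_ofPred_eq, wordEquiv_snd, not_lt] at hi ⊢
      obtain ⟨h1, h2, h3⟩ := hi
      have := hS' i
      rw [dif_pos h3]
      refine ⟨by simp only; omega, ?_⟩
      have e : highCol (⟨f i - n, by omega⟩ : Fin n) = f i :=
        Fin.ext (by simp only [highCol]; omega)
      rw [e]
      exact hI i
    · intro i hi j hj hij
      simp only [coe_filter, mem_univ, true_and, Set.mem_ofPred_eq, not_lt] at hi hj
      simp only [dif_pos hi.2.2, dif_pos hj.2.2, Fin.mk.injEq] at hij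
      have := hi.2.2
      have := hj.2.2
      exact hf (Fin.ext (by omega))

lemma exists_cnt_eq (Q : Fin n → Prop) :
    ∀ s ≤ n, ∀ k < cnt Q s, ∃ t, Q t ∧ cnt Q t = k := by
  refine cnt_induction (by simp [cnt_zero]) fun i ih k hk => ?_
  by_cases hQ : Q i
  · rw [cnt_succ_of_pos hQ] at hk
    rcases (Nat.lt_succ_iff.1 hk).lt_or_eq with h | h
    · exact ih k h
    · exact ⟨i, hQ, h.symm⟩
  · rw [cnt_succ_of_neg hQ] at hk
    exact ih k hk

lemma cnt_lt_cnt {P : Fin n → Prop} {i : Fin n} (hi : P i) {s : ℕ} (h : (i : ℕ) < s) :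
    cnt P i < cnt P s := by
  have h1 := cnt_succ_of_pos hi
  have h2 := cnt_mono P (show (i : ℕ) + 1 ≤ s from h)
  omega

/-- Rows whose right end is in the set take it; the `k`-th remaining row takes the `k`-th column of
the set in the left half, counted from the middle. -/
lemma RankEq.hasMatching {v : Equiv.Perm (Fin n)} {I : Finset (Fin (2 * n))} (hI : #I = n)
    (h : RankEq (compl v) (wordEquiv n I)) : HasMatching v I := by
  classical
  rw [card_eq_cnt] at hI
  have hB := cnt_add_cnt_not (fun i => (wordEquiv n I i).2 = true) n le_rfl
  have hex : ∀ i : Fin n, ∃ t : Fin n, ¬ (wordEquiv n I i).2 = true →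
      (wordEquiv n I t).1 = true ∧
        cntFst (wordEquiv n I) t = cnt (fun i => ¬ (wordEquiv n I i).2 = true) i := by
    intro i
    by_cases hi : ¬ (wordEquiv n I i).2 = true
    · have := cnt_lt_cnt (P := fun i => ¬ (wordEquiv n I i).2 = true) hi i.2
      obtain ⟨t, ht⟩ := exists_cnt_eq (fun i => (wordEquiv n I i).1 = true) n le_rfl
        (cnt (fun i => ¬ (wordEquiv n I i).2 = true) i)
        (by dsimp only [cntFst, cntSnd] at hI; omega)
      exact ⟨t, fun _ => ht⟩
    · exact ⟨i, fun h => absurd h hi⟩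
  choose e he using hex
  have hle : ∀ i, ¬ (wordEquiv n I i).2 = true → e i ≤ compl v i := by
    intro i hi
    obtain ⟨h1, h2⟩ := he i hi
    by_contra hlt
    have e1 := cnt_mono (fun i => (wordEquiv n I i).1 = true)
      (show (compl v i : ℕ) + 1 ≤ e i by omega)
    have e2 := rk_succ_of_lt (Nat.lt_succ_self (compl v i : ℕ))
    have e3 := cnt_add_cnt_not (fun i => (wordEquiv n I i).2 = true) i i.2.le
    have e4 := cnt_succ_of_neg (P := fun i => (wordEquiv n I i).2 = true) hi
    rw [h _ (by omega) _ (by omega), h _ (by omega) _ (by omega)] at e2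
    dsimp only [cntFst, cntSnd, Nat.succ_eq_add_one] at *
    omega
  refine ⟨fun i => if (wordEquiv n I i).2 = true then highCol i else lowCol (e i), ?_, fun i => ?_⟩
  · intro i j hij
    dsimp only at hij
    by_cases hi : (wordEquiv n I i).2 = true <;> by_cases hj : (wordEquiv n I j).2 = true <;>
      simp only [hi, hj, if_true, if_false, Bool.false_eq_true, lowCol, highCol,
        Fin.mk.injEq] at hij
    · exact Fin.ext (by omega)
    · omega
    · omega
    · have hee : e i = e j := Fin.ext (by omega)
      have e1 := (he i hi).2
      have e2 := (he j hj).2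
      rw [hee, e2] at e1
      rcases lt_trichotomy i j with hlt | heq | hlt
      · have := cnt_lt_cnt (P := fun i => ¬ (wordEquiv n I i).2 = true) hi hlt
        omega
      · exact heq
      · have := cnt_lt_cnt (P := fun i => ¬ (wordEquiv n I i).2 = true) hj hlt
        omega
  · dsimp only
    by_cases hi : (wordEquiv n I i).2 = true
    · rw [if_pos hi]
      refine ⟨(wordEquiv_snd I i).1 hi, ?_⟩
      simp only [Support, Set.mem_ofPred_eq, highCol]
      omega
    · rw [if_neg hi]
      refine ⟨(wordEquiv_fst I _).1 (he i hi).1, ?_⟩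
      have h1 := Fin.le_def.1 (hle i hi)
      rw [compl_apply, Fin.val_rev] at h1
      simp only [Support, Set.mem_ofPred_eq, lowCol]
      omega

lemma hasMatching_iff_bruhatLE {w v : Equiv.Perm (Fin n)} {I : Finset (Fin (2 * n))} (hI : #I = n)
    (h : RankEq (compl v) (wordEquiv n I)) : HasMatching w I ↔ BruhatLE w v := by
  refine ⟨fun hw => bruhatLE_of_rk_le w v fun s hs y hy => ?_,
    fun hle => (h.hasMatching hI).of_bruhatLE hle⟩
  rw [h s hs y hy]
  exact le_min (hw.rk_le s y) (le_min (rk_le_left _ hs y) (rk_le_right _ s hy))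

/-! ### Minors -/

/-- A minor of a generic matrix is a nonzero polynomial in the entries as soon as it has a nonzero
specialization, and a matching provides a permutation matrix. -/
lemma det_ne_zero_iff {F K : Type*} [Field F] [Field K] [Algebra F K] {w : Equiv.Perm (Fin n)}
    {M : Matrix (Fin n) (Fin (2 * n)) K} (hM : IsGeneric F w M) {I : Finset (Fin (2 * n))}
    (hI : #I = n) : (M.submatrix id (I.orderEmbOfFin hI)).det ≠ 0 ↔ HasMatching w I := by
  classical
  constructor
  · intro hdet
    rw [Matrix.det_apply] at hdet
    obtain ⟨σ, -, hσ⟩ := exists_ne_zero_of_sum_ne_zero hdet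
    have hprod : ∀ i, M (σ i) (I.orderEmbOfFin hI i) ≠ 0 := by
      intro i h0
      apply hσ
      rw [prod_eq_zero (mem_univ i) (by simpa using h0), smul_zero]
    refine ⟨fun i => I.orderEmbOfFin hI (σ⁻¹ i),
      (I.orderEmbOfFin hI).injective.comp σ⁻¹.injective, fun i => ⟨orderEmbOfFin_mem _ _ _, ?_⟩⟩
    by_contra hS
    have := hprod (σ⁻¹ i)
    rw [Equiv.Perm.coe_inv, Equiv.apply_symm_apply] at this
    exact this (hM.zero_off _ _ hS)
  · rintro ⟨f, hf, hS⟩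
    let A : Matrix (Fin n) (Fin (2 * n)) (MvPolynomial (Support w) F) := fun i j =>
      if h : (i, j) ∈ Support w then MvPolynomial.X ⟨(i, j), h⟩ else 0
    have hA : ∀ i j, A i j =
      if h : (i, j) ∈ Support w then MvPolynomial.X ⟨(i, j), h⟩ else 0 := fun _ _ => rfl
    let φ : MvPolynomial (Support w) F →ₐ[F] K := MvPolynomial.aeval
      (fun p : Support w => M (p : Fin n × Fin (2 * n)).1 (p : Fin n × Fin (2 * n)).2)
    have hφ : (M.submatrix id (I.orderEmbOfFin hI)) =
        φ.mapMatrix (A.submatrix id (I.orderEmbOfFin hI)) := by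
      ext i k
      simp only [AlgHom.mapMatrix_apply, Matrix.map_apply, Matrix.submatrix_apply, id, hA]
      split_ifs with h
      · simp [φ]
      · rw [map_zero, hM.zero_off _ _ h]
    rw [hφ, ← AlgHom.map_det, Ne, map_eq_zero_iff φ hM.algebraicIndependent]
    have hσ : ∀ i, ∃ k, I.orderEmbOfFin hI k = f i := by
      intro i
      have : f i ∈ Set.range (I.orderEmbOfFin hI) := by
        rw [range_orderEmbOfFin]
        exact (hS i).1
      exact this
    choose σ hσ using hσ
    have hinj : Function.Injective σ := fun i j hij => hf (by rw [← hσ i, ← hσ j, hij])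
    let τ : Equiv.Perm (Fin n) := Equiv.ofBijective σ (Finite.injective_iff_bijective.1 hinj)
    let ψ : MvPolynomial (Support w) F →ₐ[F] F := MvPolynomial.aeval
      (fun p : Support w => if (p : Fin n × Fin (2 * n)).2 = f (p : Fin n × Fin (2 * n)).1
        then 1 else 0)
    have hψ : ψ.mapMatrix (A.submatrix id (I.orderEmbOfFin hI)) =
        (1 : Matrix (Fin n) (Fin n) F).submatrix τ id := by
      ext i k
      have hiff : I.orderEmbOfFin hI k = f i ↔ τ i = k := by
        rw [← hσ i, (I.orderEmbOfFin hI).injective.eq_iff]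
        exact eq_comm
      simp only [AlgHom.mapMatrix_apply, Matrix.map_apply, Matrix.submatrix_apply, id, hA,
        Matrix.one_apply]
      split_ifs with h1 h2 h2
      · simp [ψ, hiff, h2]
      · simp [ψ, hiff, h2]
      · refine absurd ?_ h1
        rw [hiff.2 h2]
        exact (hS i).2
      · simp
    intro h0
    have h1 := congrArg ψ h0
    rw [AlgHom.map_det, hψ, map_zero, Matrix.det_permute, Matrix.det_one, mul_one] at h1
    rcases Int.units_eq_one_or (Equiv.Perm.sign τ) with h2 | h2 <;> simp [h2] at h1

lemma mem_bases_iff {F K : Type*} [Field F] [Field K] [Algebra F K] {w : Equiv.Perm (Fin n)}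
    {M : Matrix (Fin n) (Fin (2 * n)) K} (hM : IsGeneric F w M) (I : Finset (Fin (2 * n))) :
    I ∈ bases M ↔ #I = n ∧ HasMatching w I :=
  ⟨fun ⟨h, hd⟩ => ⟨h, (det_ne_zero_iff hM h).1 hd⟩,
    fun ⟨h, hm⟩ => ⟨h, (det_ne_zero_iff hM h).2 hm⟩⟩

open scoped Classical in
lemma ncard_bases {F K : Type*} [Field F] [Field K] [Algebra F K] {w : Equiv.Perm (Fin n)}
    {M : Matrix (Fin n) (Fin (2 * n)) K} (hM : IsGeneric F w M) :
    (bases M).ncard = ∑ v : Equiv.Perm (Fin n) with BruhatLE w v ∧ Avoids123 v, g v := by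
  have hfib : ∀ v : Equiv.Perm (Fin n),
      #{I | InFiber (compl v) (wordEquiv n I)} = g v := by
    intro v
    rw [← card_inFiber v]
    exact card_equiv (wordEquiv n) (by simp)
  have hset : bases M = ((univ.filter fun v : Equiv.Perm (Fin n) =>
      BruhatLE w v ∧ Avoids123 v).biUnion fun v =>
        {I | InFiber (compl v) (wordEquiv n I)} : Finset (Finset (Fin (2 * n)))) := by
    ext I
    simp only [mem_bases_iff hM, coe_biUnion, coe_filter, mem_univ, true_and, Set.mem_ofPred_eq,
      Set.mem_iUnion, exists_prop]
    constructor
    · rintro ⟨hI, hm⟩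
      obtain ⟨u, hu⟩ := exists_rankEq ((card_eq_cnt I).symm.trans hI)
      have hcu : compl (compl u) = u := by
        ext i
        simp [compl_apply]
      rw [← hcu] at hu
      exact ⟨compl u, ⟨(hasMatching_iff_bruhatLE hI hu).1 hm,
        (avoids321_compl_iff _).1 hu.avoids321⟩, hu.inFiber ((card_eq_cnt I).symm.trans hI)⟩
    · rintro ⟨v, ⟨hle, hv⟩, hx⟩
      have hv' := (avoids321_compl_iff v).2 hv
      have hI : #I = n := (card_eq_cnt I).trans (hx.cnt_add_cnt hv')
      exact ⟨hI, (hasMatching_iff_bruhatLE hI (hx.rankEq hv')).2 hle⟩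
  rw [hset, Set.ncard_coe_finset, card_biUnion]
  · exact sum_congr rfl fun v _ => hfib v
  · intro v hv v' hv' hne
    change Disjoint _ _
    rw [disjoint_left]
    intro I hI hI'
    simp only [mem_coe, mem_filter, mem_univ, true_and] at hv hv' hI hI'
    exact hne (compl_injective ((hI.rankEq ((avoids321_compl_iff v).2 hv.2)).unique
      (hI'.rankEq ((avoids321_compl_iff v').2 hv'.2))))

/-! ### The longest element -/

lemma eq_of_bruhatLE_revPerm {v : Equiv.Perm (Fin n)} (h : BruhatLE Fin.revPerm v) :
    v = Fin.revPerm := by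
  induction h with
  | refl => rfl
  | tail _ hstep ih =>
    subst ih
    obtain ⟨i, j, hij, hw, -⟩ := hstep
    simp only [Fin.revPerm_apply, Fin.rev_lt_rev] at hw
    exact absurd hij hw.not_gt

lemma avoids123_revPerm : Avoids123 (Fin.revPerm : Equiv.Perm (Fin n)) := by
  rintro ⟨i, j, k, hij, -, hw, -⟩
  simp only [Fin.revPerm_apply, Fin.rev_lt_rev] at hw
  exact hij.not_gt hw

lemma g_revPerm (n : ℕ) : g (Fin.revPerm : Equiv.Perm (Fin n)) = catalan (n + 1) := by
  classical
  rcases n with _ | n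
  · rw [g, Finset.prod_eq_one fun r _ => r.1.elim0]
    simp
  · have hrun : ∀ a b : Fin (n + 1), a ≤ b → IsRun (Fin.revPerm : Equiv.Perm (Fin (n + 1))) a b :=
      fun a b hab => ⟨hab, fun _ _ _ => rfl⟩
    have h : (univ.filter fun r : Fin (n + 1) × Fin (n + 1) =>
        IsMaxRun (Fin.revPerm : Equiv.Perm (Fin (n + 1))) r.1 r.2) = {(0, Fin.last n)} := by
      ext ⟨a, b⟩
      simp only [mem_filter, mem_univ, true_and, mem_singleton, Prod.mk.injEq]
      constructor
      · intro hm
        have := hm.2 0 (Fin.last n) (Fin.zero_le _) (Fin.le_last _) (hrun _ _ (Fin.zero_le _))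
        exact ⟨this.1.symm, this.2.symm⟩
      · rintro ⟨rfl, rfl⟩
        exact ⟨hrun _ _ (Fin.zero_le _), fun a' b' ha hb _ =>
          ⟨le_antisymm ha (Fin.zero_le _), le_antisymm (Fin.le_last _) hb⟩⟩
    rw [g, h, prod_singleton]
    simp

end CatalanPositroid

open scoped Classical in
theorem theorem1p1 (n : ℕ) {F K : Type*} [Field F] [Field K] [Algebra F K] :
    (∀ (w : Equiv.Perm (Fin n)) (M : Matrix (Fin n) (Fin (2 * n)) K),
      CatalanPositroid.IsGeneric F w M →
        (CatalanPositroid.bases M).ncard =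
          ∑ v : Equiv.Perm (Fin n) with
            CatalanPositroid.BruhatLE w v ∧ CatalanPositroid.Avoids123 v, CatalanPositroid.g v) ∧
    (∀ M : Matrix (Fin n) (Fin (2 * n)) K,
      CatalanPositroid.IsGeneric F (Fin.revPerm : Equiv.Perm (Fin n)) M →
        (CatalanPositroid.bases M).ncard = catalan (n + 1)) := by
  refine ⟨fun w M hM => CatalanPositroid.ncard_bases hM, fun M hM => ?_⟩
  rw [CatalanPositroid.ncard_bases hM, ← CatalanPositroid.g_revPerm n]
  have h : (Finset.univ.filter fun v : Equiv.Perm (Fin n) =>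
      CatalanPositroid.BruhatLE Fin.revPerm v ∧ CatalanPositroid.Avoids123 v) =
        {Fin.revPerm} := by
    ext v
    simp only [Finset.mem_filter, Finset.mem_univ, true_and, Finset.mem_singleton]
    constructor
    · exact fun hv => CatalanPositroid.eq_of_bruhatLE_revPerm hv.1
    · rintro rfl
      exact ⟨Relation.ReflTransGen.refl, CatalanPositroid.avoids123_revPerm⟩
  rw [h, Finset.sum_singleton]
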